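/- For integers $d \ge 1$ and $j \ge 0$, let $\mathcal{B}_j$ be the set of half-open boxes $2^{-j}k + [0,2^{-j})^d$, $k \in \mathbb{Z}^d$, which partition $\mathbb{R}^d$, and for $x \in \mathbb{R}^d$ let $\mathcal{B}_j(x)$ be the unique box in $\mathcal{B}_j$ that contains $x$. Let $\{a_{j,B}\}_{j \ge 0,\, B \in \mathcal{B}_j}$ be i.i.d. Gaussian random variables with mean $0$ and variance $\log 2$, and define the branching random walk $$\mathcal{R}_n(x) = \sum_{j=0}^n a_{j,\mathcal{B}_j(x)}, \qquad x \in \mathbb{R}^d,\ n \ge 1,$$ and, for $\alpha > 0$, its set of $\alpha$-thick points $$\mathscr{T}_\alpha = \Big\{x \in \mathbb{R}^d : \liminf_{n \to \infty} \tfrac1n \mathcal{R}_n(x) \ge \alpha\Big\}.$$ **Theorem.** For every $\alpha > 0$ there exists a constant $C > 0$, depending only on $\alpha$, such that for all integers $d \ge C$, almost surely the set $\mathscr{T}_\alpha$ contains an unbounded path, that is, there exists a continuous map $\varphi : [0,\infty) \to \mathbb{R}^d$ with $\varphi([0,\infty)) \subset \mathscr{T}_\alpha$ and $|\varphi(t)|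 \to \infty$ as $t \to \infty$. -/

import Mathlib

open MeasureTheory ProbabilityTheory Filter Topology

noncomputable section

namespace BRW

/-- The half-open dyadic box `2 ^ (-j) • k + [0, 2 ^ (-j)) ^ d`, for `k` in the integer lattice. -/
def dyadicBox {d : ℕ} (j : ℕ) (k : Fin d → ℤ) : Set (EuclideanSpace ℝ (Fin d)) :=
  {x | ∀ i, x i ∈ Set.Ico ((k i : ℝ) / 2 ^ j) (((k i : ℝ) + 1) / 2 ^ j)}

/-- The label `k` of the unique box `dyadicBox j k` that contains `x`
(see `mem_dyadicBox_iff`). -/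
def boxIndex {d : ℕ} (j : ℕ) (x : EuclideanSpace ℝ (Fin d)) : Fin d → ℤ :=
  fun i => ⌊(2 : ℝ) ^ j * x i⌋

/-- The boxes of a given level are pairwise disjoint, they cover the space, and the one that
contains `x` has the label `boxIndex j x`. -/
theorem mem_dyadicBox_iff {d : ℕ} (j : ℕ) (k : Fin d → ℤ) (x : EuclideanSpace ℝ (Fin d)) :
    x ∈ dyadicBox j k ↔ boxIndex j x = k := by
  have h2 : (0 : ℝ) < 2 ^ j := by positivity
  simp only [dyadicBox, boxIndex, Set.mem_ofPred_eq, Set.mem_Ico, funext_iff, Int.floor_eq_iff,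
    div_le_iff₀ h2, lt_div_iff₀ h2, mul_comm]

/-- Different labels give different boxes, so that a family indexed by the labels is the same
as a family indexed by the boxes. -/
theorem dyadicBox_injective {d : ℕ} (j : ℕ) :
    Function.Injective (dyadicBox (d := d) j) := by
  intro k l h
  have hk : WithLp.toLp 2 (fun i => (k i : ℝ) / 2 ^ j) ∈ dyadicBox j k := by
    intro i
    refine ⟨le_rfl, ?_⟩
    have h2 : (0 : ℝ) < 2 ^ j := by positivity
    exact div_lt_div_of_pos_right (lt_add_one _) h2
  have hl := hk
  rw [h] at hl
  rw [mem_dyadicBox_iff] at hk hl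
  exact hk.symm.trans hl

/-- The branching random walk `R_n(x) = ∑_{j = 0}^{n} a_{j, B_j(x)}`, for a realization `a` of the
increments; `a (j, k)` is the increment attached to the box `dyadicBox j k`. -/
def walk {d : ℕ} (a : ℕ × (Fin d → ℤ) → ℝ) (n : ℕ) (x : EuclideanSpace ℝ (Fin d)) : ℝ :=
  ∑ j ∈ Finset.range (n + 1), a (j, boxIndex j x)

/-- The set of `α`-thick points `{x | liminf_n R_n(x) / n ≥ α}`. The liminf is taken in the
extended reals, so that it is the true one also where `R_n(x) / n` is unbounded. -/
def thickPoints {d : ℕ} (a : ℕ × (Fin d → ℤ) → ℝ) (α : ℝ) : Set (EuclideanSpace ℝ (Fin d)) :=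
  {x | (α : EReal) ≤ liminf (fun n : ℕ => ((walk a n x / (n : ℝ) : ℝ) : EReal)) atTop}

/-- `S` contains an unbounded path: there is a continuous `φ : [0, ∞) → ℝ^d` with values in `S`
that connects its starting point to infinity, `|φ(t)| → ∞`. In particular, the path
`φ([0, ∞))` is an unbounded set. -/
def ContainsUnboundedPath {d : ℕ} (S : Set (EuclideanSpace ℝ (Fin d))) : Prop :=
  ∃ φ : NNReal → EuclideanSpace ℝ (Fin d),
    Continuous φ ∧ Tendsto (fun t => ‖φ t‖) atTop atTop ∧ ∀ t, φ t ∈ S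

end BRW

end

/-! A path along a coordinate axis is refined scale by scale by the factor 4. Each box of the path
is replaced by nine subboxes that lead from the face of entry through the middle to the face of
exit. Every crossing of a face and every interior passage may be shifted in one free coordinate out
of `d`. Apart from at most four coordinates, distinct choices involve disjoint sets of at most 14
independent variables. Hence the probability that no choice makes all values at least `H = α + 2` is
exponentially small in `d` (`measure_fails_le`).

Since the chosen path depends on the values, the rare failures are controlled by a first moment over
all conceivable lines of descendants, with `9 * d ^ 3` children per node. A child contributes no
deficit on success. On failure, the exponential moment of order `c = log (36 * d ^ 3)` costs only
`exp (O((log d) ^ 2))`, which the failure probability outweighs (`exists_dimension_bound`). The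
weights of lines of length `N` then sum to at most `(18 * d ^ 3) ^ N` in mean
(`lintegral_weightSum_le`). By Markov and Borel-Cantelli, all lines of the path that start at a
given unit box eventually have total deficit at most `N` (`ae_eventually_sum_deficit_le`). This
leaves slope at least `α` (`mem_thickPoints_of_deficit`).

The box paths converge to a continuous curve, and at every scale the half-open box of each of its
points belongs to the path (`boxIndex_limitPath`). -/

noncomputable section

namespace BRW

variable {d : ℕ}

/-! ### Geometry of the refinement of a single box. -/

/-- A displacement between two equal or face-adjacent boxes of the same level. -/
def IsStep (δ : Fin d → ℤ) : Prop :=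
  ∃ i, |δ i| ≤ 1 ∧ ∀ j, j ≠ i → δ j = 0

/-- The base-4 digit of a subbox that touches the face in direction `e`, and `b` if `e = 0`. -/
def faceDigit (e b : ℤ) : ℤ := if e = 1 then 3 else if e = -1 then 0 else b

/-- The base-4 digit on the way from the middle to the face in direction `e`. -/
def nearDigit (e b : ℤ) : ℤ := if e = 1 then 2 else if e = -1 then 1 else b

/-- The digits of the subbox through which the path leaves a box with displacement `δ`;
the coordinate `k` is free. -/
def port (δ : Fin d → ℤ) (k : Fin d) : Fin d → ℤ :=
  fun j => faceDigit (δ j) (if j = k then 2 else 1)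

/-- The digits of the nine subboxes which the path visits in a box that it enters with displacement
`δ₁` and leaves with displacement `δ₂`; the coordinates `k₁`, `k₂` and `m` are free. -/
def route (δ₁ δ₂ : Fin d → ℤ) (k₁ k₂ m : Fin d) (r : ℕ) : Fin d → ℤ := fun j =>
  match r with
  | 0 => faceDigit (-δ₁ j) (if j = k₁ then 2 else 1)
  | 1 => faceDigit (-δ₁ j) (if j = k₁ ∨ j = m then 2 else 1)
  | 2 => nearDigit (-δ₁ j) (if j = k₁ ∨ j = m then 2 else 1)
  | 3 => if j = k₁ ∨ j = m then 2 else 1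
  | 4 => if j = k₁ ∨ j = k₂ ∨ j = m then 2 else 1
  | 5 => if j = k₂ ∨ j = m then 2 else 1
  | 6 => nearDigit (δ₂ j) (if j = k₂ ∨ j = m then 2 else 1)
  | 7 => faceDigit (δ₂ j) (if j = k₂ ∨ j = m then 2 else 1)
  | _ => faceDigit (δ₂ j) (if j = k₂ then 2 else 1)

theorem route_mem (δ₁ δ₂ : Fin d → ℤ) (k₁ k₂ m : Fin d) (r : ℕ) (j : Fin d) :
    0 ≤ route δ₁ δ₂ k₁ k₂ m r j ∧ route δ₁ δ₂ k₁ k₂ m r j ≤ 3 := by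
  unfold route faceDigit nearDigit
  split <;> split_ifs <;> norm_num

/-- A subbox touches an upper face of its box only where the path crosses that face. A limit point
on an upper face, which the half-open box omits, therefore lies in the preceding or following box of
the path. -/
theorem route_eq_three_unique {δ₁ δ₂ : Fin d → ℤ} (h₁ : IsStep δ₁) (h₂ : IsStep δ₂)
    {k₁ k₂ m : Fin d} {r : ℕ} {j : Fin d} (h : route δ₁ δ₂ k₁ k₂ m r j = 3) :
    ∃ δ : Fin d → ℤ, (δ = -δ₁ ∨ δ = δ₂) ∧ δ j = 1 ∧
      ∀ i, i ≠ j → δ i = 0 ∧ route δ₁ δ₂ k₁ k₂ m r i ≤ 2 := by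
  obtain ⟨i₁, hi₁, hj₁⟩ := h₁
  obtain ⟨i₂, hi₂, hj₂⟩ := h₂
  have aux : (r ≤ 1 ∧ δ₁ j = -1) ∨ (7 ≤ r ∧ δ₂ j = 1) := by
    match r with
    | 0 | 1 | 2 | 3 | 4 | 5 | 6 | 7 | r + 8 =>
      simp only [route, faceDigit, nearDigit] at h
      split_ifs at h <;> omega
  rcases aux with ⟨hr, hj⟩ | ⟨hr, hj⟩
  · have hji : j = i₁ := by
      by_contra hne
      have := hj₁ j hne
      omega
    subst hji
    refine ⟨-δ₁, Or.inl rfl, by simp [hj], fun i hi => ?_⟩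
    have h0 := hj₁ i hi
    refine ⟨by simp [h0], ?_⟩
    match r, hr with
    | 0, _ | 1, _ =>
      simp only [route, faceDigit, h0]
      split_ifs <;> norm_num at *
  · have hji : j = i₂ := by
      by_contra hne
      have := hj₂ j hne
      omega
    subst hji
    refine ⟨δ₂, Or.inr rfl, hj, fun i hi => ?_⟩
    have h0 := hj₂ i hi
    refine ⟨h0, ?_⟩
    match r, hr with
    | 7, _ | r + 8, _ =>
      simp only [route, faceDigit, h0]
      split_ifs <;> norm_num at *

/-- The last subbox of a box and the first subbox of the next one share the free coordinate `k`, so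
they differ only across the common face, where `4 + 0 - 3 = 1`. -/
theorem isStep_port {δ : Fin d → ℤ} (h : IsStep δ) (k : Fin d) :
    IsStep ((4 : ℤ) • δ + port (-δ) k - port δ k) := by
  obtain ⟨i, hi, hj⟩ := h
  refine ⟨i, ?_, fun j hji => ?_⟩
  · rw [abs_le] at hi ⊢
    simp only [port, faceDigit, Pi.add_apply, Pi.sub_apply, Pi.smul_apply, Pi.neg_apply, smul_eq_mul]
    have : δ i = -1 ∨ δ i = 0 ∨ δ i = 1 := by omega
    rcases this with h | h | h <;> simp [h]
  · simp [port, faceDigit, hj j hji]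

/-- Only one coordinate changes at a time: `m` is switched on, the path moves inwards in two steps,
`k₂` is switched on, `k₁` off, the path moves outwards in two steps, and `m` is switched off.
Coinciding coordinates merely produce null steps. -/
theorem isStep_route {δ₁ δ₂ : Fin d → ℤ} (h₁ : IsStep δ₁) (h₂ : IsStep δ₂)
    (k₁ k₂ m : Fin d) (r : ℕ) :
    IsStep (route δ₁ δ₂ k₁ k₂ m (r + 1) - route δ₁ δ₂ k₁ k₂ m r) := by
  obtain ⟨i₁, hi₁, hj₁⟩ := h₁
  obtain ⟨i₂, hi₂, hj₂⟩ := h₂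
  have key : ∀ i : Fin d, |route δ₁ δ₂ k₁ k₂ m (r + 1) i - route δ₁ δ₂ k₁ k₂ m r i| ≤ 1 →
      (∀ j, j ≠ i → route δ₁ δ₂ k₁ k₂ m (r + 1) j = route δ₁ δ₂ k₁ k₂ m r j) →
      IsStep (route δ₁ δ₂ k₁ k₂ m (r + 1) - route δ₁ δ₂ k₁ k₂ m r) := fun i h1 h2 =>
    ⟨i, h1, fun j hj => sub_eq_zero.2 (h2 j hj)⟩
  match r with
  | 0 | 7 =>
    refine key m ?_ fun j hj => by simp [route, hj]
    simp only [route, faceDigit, or_true, if_true]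
    split_ifs <;> norm_num
  | 1 | 2 =>
    refine key i₁ ?_ fun j hj => by simp [route, hj₁ j hj, faceDigit, nearDigit]
    simp only [route, faceDigit, nearDigit]
    split_ifs <;> norm_num
  | 3 =>
    refine key k₂ ?_ fun j hj => by simp [route, hj]
    simp only [route, true_or, or_true, if_true]
    split_ifs <;> norm_num
  | 4 =>
    refine key k₁ ?_ fun j hj => by simp [route, hj]
    simp only [route, true_or, if_true]
    split_ifs <;> norm_num
  | 5 | 6 =>
    refine key i₂ ?_ fun j hj => by simp [route, hj₂ j hj, faceDigit, nearDigit]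
    simp only [route, faceDigit, nearDigit]
    split_ifs <;> norm_num
  | r + 8 => exact key m (by simp [route]) fun j hj => by simp [route]

/-- A box on the path, with the displacements from its predecessor and to its successor. -/
structure Node (d : ℕ) where
  box : Fin d → ℤ
  inc : Fin d → ℤ
  out : Fin d → ℤ

/-- The displacements of a node are admissible. -/
def Node.Valid (σ : Node d) : Prop := IsStep σ.inc ∧ IsStep σ.out

/-- The node number `r` of the refinement of the node `σ`. -/
def Node.next (σ : Node d) (k₁ k₂ m : Fin d) (r : ℕ) : Node d where
  box := (4 : ℤ) • σ.box + route σ.inc σ.out k₁ k₂ m r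
  inc := if r = 0 then (4 : ℤ) • σ.inc + port (-σ.inc) k₁ - port σ.inc k₁
    else route σ.inc σ.out k₁ k₂ m r - route σ.inc σ.out k₁ k₂ m (r - 1)
  out := if r = 8 then (4 : ℤ) • σ.out + port (-σ.out) k₂ - port σ.out k₂
    else route σ.inc σ.out k₁ k₂ m (r + 1) - route σ.inc σ.out k₁ k₂ m r

theorem Node.Valid.next {σ : Node d} (h : σ.Valid) (k₁ k₂ m : Fin d) (r : ℕ) :
    (σ.next k₁ k₂ m r).Valid := by
  constructor
  · unfold Node.next
    dsimp only
    split_ifs with h0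
    · exact isStep_port h.1 _
    · obtain ⟨r, rfl⟩ := Nat.exists_eq_succ_of_ne_zero h0
      exact isStep_route h.1 h.2 k₁ k₂ m r
  · unfold Node.next
    dsimp only
    split_ifs with h0
    · exact isStep_port h.2 _
    · exact isStep_route h.1 h.2 k₁ k₂ m r

/-- A rule for the free coordinates: one for each pair of consecutive boxes, and one for each box. -/
structure Rule (d : ℕ) where
  edge : ℕ → (Fin d → ℤ) → (Fin d → ℤ) → Fin d
  mid : ℕ → Node d → Fin d → Fin d → Fin d

/-! ### The refined box paths and their continuous limit. -/

section Path

variable [NeZero d]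

/-- The path of boxes of side `4 ^ (-n)`: each box is refined into nine subboxes, starting from the
boxes of side `1` along a coordinate axis. -/
def boxPath (R : Rule d) : ℕ → ℤ → Fin d → ℤ
  | 0, s => Pi.single 0 s
  | n + 1, u =>
    let B := boxPath R n (u / 9)
    let δ₁ := B - boxPath R n (u / 9 - 1)
    let δ₂ := boxPath R n (u / 9 + 1) - B
    let k₁ := R.edge n (boxPath R n (u / 9 - 1)) δ₁
    let k₂ := R.edge n B δ₂
    (4 : ℤ) • B + route δ₁ δ₂ k₁ k₂ (R.mid n ⟨B, δ₁, δ₂⟩ k₁ k₂) (u % 9).toNat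

/-- The node of the path at the time `s`. -/
def pathNode (R : Rule d) (n : ℕ) (s : ℤ) : Node d where
  box := boxPath R n s
  inc := boxPath R n s - boxPath R n (s - 1)
  out := boxPath R n (s + 1) - boxPath R n s

/-- The free coordinate which the rule assigns to the pair of a node and its predecessor. -/
def Rule.edgeIn (R : Rule d) (n : ℕ) (σ : Node d) : Fin d := R.edge n (σ.box - σ.inc) σ.inc

/-- The free coordinate which the rule assigns to the pair of a node and its successor. -/
def Rule.edgeOut (R : Rule d) (n : ℕ) (σ : Node d) : Fin d := R.edge n σ.box σ.out

/-- The refinement of a node according to the rule. -/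
def Rule.child (R : Rule d) (n : ℕ) (σ : Node d) (r : ℕ) : Node d :=
  σ.next (R.edgeIn n σ) (R.edgeOut n σ) (R.mid n σ (R.edgeIn n σ) (R.edgeOut n σ)) r

theorem boxPath_succ (R : Rule d) (n : ℕ) (s : ℤ) (r : ℕ) (hr : r < 9) :
    boxPath R (n + 1) (9 * s + r) = (R.child n (pathNode R n s) r).box := by
  have h1 : (9 * s + (r : ℤ)) / 9 = s := by omega
  have h2 : ((9 * s + (r : ℤ)) % 9).toNat = r := by omega
  rw [boxPath]
  simp only [h1, h2, Rule.child, Node.next, pathNode, Rule.edgeIn, Rule.edgeOut, sub_sub_cancel]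

/-- The refinement of a node is determined by the node alone, because both boxes at a crossing
consult the same edge rule. This makes the path a line in a tree of nodes. -/
theorem pathNode_succ (R : Rule d) (n : ℕ) (s : ℤ) (r : ℕ) (hr : r < 9) :
    pathNode R (n + 1) (9 * s + r) = R.child n (pathNode R n s) r := by
  have hbox := boxPath_succ R n s
  have e0 := hbox r hr
  have port_in : ∀ δ₁ δ₂ : Fin d → ℤ, ∀ k₁ k₂ m, route δ₁ δ₂ k₁ k₂ m 0 = port (-δ₁) k₁ :=
    fun _ _ _ _ _ => rfl
  have port_out : ∀ δ₁ δ₂ : Fin d → ℤ, ∀ k₁ k₂ m, route δ₁ δ₂ k₁ k₂ m 8 = port δ₂ k₂ :=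
    fun _ _ _ _ _ => rfl
  have hin : boxPath R (n + 1) (9 * s + r) - boxPath R (n + 1) (9 * s + r - 1)
      = (R.child n (pathNode R n s) r).inc := by
    rw [e0]
    rcases Nat.eq_zero_or_pos r with rfl | hpos
    · have : 9 * s + ((0 : ℕ) : ℤ) - 1 = 9 * (s - 1) + ((8 : ℕ) : ℤ) := by push_cast; ring
      rw [this, boxPath_succ R n (s - 1) 8 (by norm_num)]
      simp only [Rule.child, Node.next, pathNode, Rule.edgeIn, Rule.edgeOut, port_in, port_out,
        sub_sub_cancel, sub_add_cancel, if_true]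
      simp only [smul_sub]
      abel
    · have : 9 * s + (r : ℤ) - 1 = 9 * s + ((r - 1 : ℕ) : ℤ) := by omega
      rw [this, hbox (r - 1) (by omega)]
      simp only [Rule.child, Node.next, if_neg hpos.ne', add_sub_add_left_eq_sub]
  have hout : boxPath R (n + 1) (9 * s + r + 1) - boxPath R (n + 1) (9 * s + r)
      = (R.child n (pathNode R n s) r).out := by
    rw [e0]
    by_cases h8 : r = 8
    · subst h8
      have : 9 * s + ((8 : ℕ) : ℤ) + 1 = 9 * (s + 1) + ((0 : ℕ) : ℤ) := by push_cast; ring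
      rw [this, boxPath_succ R n (s + 1) 0 (by norm_num)]
      simp only [Rule.child, Node.next, pathNode, Rule.edgeIn, Rule.edgeOut, port_in, port_out,
        add_sub_cancel_right, sub_sub_cancel, if_true]
      simp only [smul_sub]
      abel
    · have : 9 * s + (r : ℤ) + 1 = 9 * s + ((r + 1 : ℕ) : ℤ) := by push_cast; ring
      rw [this, hbox (r + 1) (by omega)]
      simp only [Rule.child, Node.next, if_neg h8, add_sub_add_left_eq_sub]
  rw [pathNode, hin, hout, e0]

theorem pathNode_zero (R : Rule d) (s : ℤ) :
    pathNode R 0 s = ⟨Pi.single 0 s, Pi.single 0 1, Pi.single 0 1⟩ := by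
  simp only [pathNode, boxPath, ← Pi.single_sub]
  simp

theorem isStep_single : IsStep (Pi.single (0 : Fin d) (1 : ℤ)) :=
  ⟨0, by simp, fun j hj => by simp [hj]⟩

theorem pathNode_valid (R : Rule d) (n : ℕ) (s : ℤ) : (pathNode R n s).Valid := by
  induction n generalizing s with
  | zero => rw [pathNode_zero]; exact ⟨isStep_single, isStep_single⟩
  | succ n ih =>
    have h : s = 9 * (s / 9) + ((s % 9).toNat : ℕ) := by omega
    rw [h, pathNode_succ R n _ _ (by omega)]
    exact (ih _).next _ _ _ _

theorem boxPath_succ_eq (R : Rule d) (n : ℕ) (u : ℤ) :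
    boxPath R (n + 1) u = (R.child n (pathNode R n (u / 9)) (u % 9).toNat).box := by
  have h : u = 9 * (u / 9) + ((u % 9).toNat : ℕ) := by omega
  conv_lhs => rw [h]
  exact boxPath_succ R n _ _ (by omega)

theorem boxPath_div (R : Rule d) (n : ℕ) (u : ℤ) (j : Fin d) :
    boxPath R (n + 1) u j / 4 = boxPath R n (u / 9) j := by
  rw [boxPath_succ_eq]
  change ((4 : ℤ) * boxPath R n (u / 9) j + route _ _ _ _ _ _ j) / 4 = _
  have key : ∀ b y : ℤ, 0 ≤ y ∧ y ≤ 3 → (4 * b + y) / 4 = b := by omega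
  exact key _ _ (route_mem _ _ _ _ _ _ _)

theorem floor_pow_succ_div (t : ℝ) (n : ℕ) : ⌊(9 : ℝ) ^ (n + 1) * t⌋ / 9 = ⌊(9 : ℝ) ^ n * t⌋ := by
  have h : (9 : ℝ) ^ n * t = 9 ^ (n + 1) * t / (9 : ℕ) := by push_cast; ring
  rw [h, Int.floor_div_natCast]
  rfl

theorem floor_pow_div (t : ℝ) (n : ℕ) : ⌊(9 : ℝ) ^ n * t⌋ / 9 ^ n = ⌊t⌋ := by
  have h : t = 9 ^ n * t / ((9 ^ n : ℕ) : ℝ) := by push_cast; field_simp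
  conv_rhs => rw [h, Int.floor_div_natCast]
  push_cast
  rfl

/-- The limit of the paths of boxes, parametrized such that the boxes of side `4 ^ (-n)` take the
time `9 ^ (-n)` each. -/
def limitPath (R : Rule d) (t : ℝ) : EuclideanSpace ℝ (Fin d) :=
  WithLp.toLp 2 fun j => ⨆ n : ℕ, (boxPath R n ⌊(9 : ℝ) ^ n * t⌋ j : ℝ) / 4 ^ n

theorem limitPath_mem (R : Rule d) (t : ℝ) (n : ℕ) (j : Fin d) :
    (boxPath R n ⌊(9 : ℝ) ^ n * t⌋ j : ℝ) ≤ 4 ^ n * limitPath R t j ∧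
      4 ^ n * limitPath R t j ≤ boxPath R n ⌊(9 : ℝ) ^ n * t⌋ j + 1 := by
  set b : ℕ → ℤ := fun n => boxPath R n ⌊(9 : ℝ) ^ n * t⌋ j with hb
  have hdiv : ∀ n, 4 * b n ≤ b (n + 1) ∧ b (n + 1) + 1 ≤ 4 * (b n + 1) := by
    intro n
    have h : b (n + 1) / 4 = b n := by
      simp only [hb, boxPath_div, floor_pow_succ_div]
    omega
  have hlo : Monotone fun n => (b n : ℝ) / 4 ^ n := by
    refine monotone_nat_of_le_succ fun n => ?_
    have h : (4 : ℝ) * b n ≤ b (n + 1) := by exact_mod_cast (hdiv n).1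
    rw [div_le_div_iff₀ (by positivity) (by positivity), pow_succ]
    have := mul_le_mul_of_nonneg_right h (by positivity : (0 : ℝ) ≤ 4 ^ n)
    linarith
  have hhi : Antitone fun n => ((b n : ℝ) + 1) / 4 ^ n := by
    refine antitone_nat_of_succ_le fun n => ?_
    have h : ((b (n + 1) : ℝ) + 1) ≤ 4 * (b n + 1) := by exact_mod_cast (hdiv n).2
    rw [div_le_div_iff₀ (by positivity) (by positivity), pow_succ]
    have := mul_le_mul_of_nonneg_right h (by positivity : (0 : ℝ) ≤ 4 ^ n)
    linarith
  have hle : ∀ n, (b n : ℝ) / 4 ^ n ≤ ((b n : ℝ) + 1) / 4 ^ n := fun n => by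
    gcongr
    linarith
  have hmem := hlo.ciSup_mem_iInter_Icc_of_antitone hhi hle
  have h := Set.mem_iInter.1 hmem n
  have h4 : (0 : ℝ) < 4 ^ n := by positivity
  rw [Set.mem_Icc, div_le_iff₀ h4, le_div_iff₀ h4] at h
  rw [mul_comm ((4 : ℝ) ^ n)]
  exact h

theorem abs_boxPath_sub_le (R : Rule d) (n : ℕ) {s s' : ℤ} (h : |s - s'| ≤ 1) (j : Fin d) :
    |boxPath R n s j - boxPath R n s' j| ≤ 1 := by
  have key : ∀ s, |boxPath R n (s + 1) j - boxPath R n s j| ≤ 1 := by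
    intro s
    obtain ⟨i, hi, hj⟩ := (pathNode_valid R n s).2
    by_cases hji : j = i
    · subst hji
      exact hi
    · have : boxPath R n (s + 1) j - boxPath R n s j = 0 := hj j hji
      rw [this]
      norm_num
  have hs : s = s' ∨ s = s' + 1 ∨ s' = s + 1 := by
    rw [abs_le] at h
    omega
  rcases hs with rfl | rfl | rfl
  · simp
  · exact key s'
  · rw [abs_sub_comm]
    exact key s

/-- Times closer than `9 ^ (-n)` lie in equal or consecutive boxes of side `4 ^ (-n)`, so each
coordinate changes by at most `2 * 4 ^ (-n)`. -/
theorem continuous_limitPath (R : Rule d) : Continuous (limitPath R) := by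
  refine (PiLp.continuous_toLp 2 _).comp (continuous_pi fun j => ?_)
  change Continuous fun t => limitPath R t j
  rw [Metric.continuous_iff]
  intro t ε hε
  obtain ⟨n, hn⟩ := exists_pow_lt_of_lt_one (by positivity : 0 < ε / 2)
    (by norm_num : (1 / 4 : ℝ) < 1)
  refine ⟨1 / 9 ^ n, by positivity, fun t' ht' => ?_⟩
  rw [Real.dist_eq] at ht' ⊢
  have h9 : (0 : ℝ) < 9 ^ n := by positivity
  have h4 : (0 : ℝ) < 4 ^ n := by positivity
  have hd : |9 ^ n * t' - 9 ^ n * t| < (1 : ℝ) := by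
    rw [← mul_sub, abs_mul, abs_of_pos h9, mul_comm]
    exact (lt_div_iff₀ h9).1 ht'
  have hf : |⌊(9 : ℝ) ^ n * t'⌋ - ⌊(9 : ℝ) ^ n * t⌋| ≤ 1 := by
    generalize (9 : ℝ) ^ n * t' = x', (9 : ℝ) ^ n * t = x at hd
    rw [abs_lt] at hd
    have b1 : (⌊x'⌋ : ℝ) < (⌊x⌋ + 2 : ℤ) := by
      push_cast
      linarith [Int.floor_le x', Int.lt_floor_add_one x]
    have b2 : (⌊x⌋ : ℝ) < (⌊x'⌋ + 2 : ℤ) := by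
      push_cast
      linarith [Int.floor_le x, Int.lt_floor_add_one x']
    rw [Int.cast_lt] at b1 b2
    rw [abs_le]
    omega
  have hb : |(boxPath R n ⌊(9 : ℝ) ^ n * t'⌋ j : ℝ) - boxPath R n ⌊(9 : ℝ) ^ n * t⌋ j| ≤ 1 := by
    exact_mod_cast abs_boxPath_sub_le R n hf j
  have m1 := limitPath_mem R t n j
  have m2 := limitPath_mem R t' n j
  have hd4 : |4 ^ n * limitPath R t' j - 4 ^ n * limitPath R t j| ≤ 2 := by
    rw [abs_le] at hb ⊢
    constructor <;> linarith
  rw [← mul_sub, abs_mul, abs_of_pos h4] at hd4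
  have hn' : 2 < ε * 4 ^ n := by
    rw [div_pow, one_pow, div_lt_iff₀ h4] at hn
    linarith
  by_contra hcon
  have := mul_le_mul_of_nonneg_right (not_lt.1 hcon) h4.le
  linarith

theorem boxIndex_limitPath (R : Rule d) (t : ℝ) (n : ℕ) :
    ∃ u : ℤ, |u - ⌊(9 : ℝ) ^ n * t⌋| ≤ 1 ∧ boxIndex (2 * n) (limitPath R t) = boxPath R n u := by
  set s := ⌊(9 : ℝ) ^ n * t⌋ with hs
  set σ := pathNode R n s with hσ
  -- The digit `y` one level deeper decides: if `y j ≤ 2`, the point stays strictly below the upper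
  -- face in direction `j`.
  have hbox := boxPath_succ_eq R n ⌊(9 : ℝ) ^ (n + 1) * t⌋
  rw [floor_pow_succ_div, ← hs, ← hσ] at hbox
  generalize (⌊(9 : ℝ) ^ (n + 1) * t⌋ % 9).toNat = r at hbox
  set y := route σ.inc σ.out (R.edgeIn n σ) (R.edgeOut n σ)
    (R.mid n σ (R.edgeIn n σ) (R.edgeOut n σ)) r with hy
  have hB : ∀ j, boxPath R (n + 1) ⌊(9 : ℝ) ^ (n + 1) * t⌋ j = 4 * boxPath R n s j + y j := by
    intro j
    rw [hbox]
    rfl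
  have hx : ∀ j, (boxPath R n s j : ℝ) ≤ 4 ^ n * limitPath R t j ∧
      4 ^ n * limitPath R t j ≤ boxPath R n s j + ((y j : ℝ) + 1) / 4 := by
    intro j
    have h1 := limitPath_mem R t (n + 1) j
    rw [hB, pow_succ] at h1
    push_cast at h1
    exact ⟨(limitPath_mem R t n j).1, by linarith [h1.2]⟩
  have hy3 : ∀ j, y j ≤ 3 := fun j => (route_mem _ _ _ _ _ _ j).2
  have hfl : ∀ j, boxIndex (2 * n) (limitPath R t) j = ⌊(4 : ℝ) ^ n * limitPath R t j⌋ := by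
    intro j
    simp only [boxIndex, pow_mul]
    norm_num
  have hin : ∀ j, y j ≤ 2 → boxIndex (2 * n) (limitPath R t) j = boxPath R n s j := by
    intro j hj
    have hj' : (y j : ℝ) ≤ 2 := by exact_mod_cast hj
    rw [hfl, Int.floor_eq_iff]
    exact ⟨(hx j).1, by linarith [(hx j).2]⟩
  by_cases hall : ∀ j, boxIndex (2 * n) (limitPath R t) j = boxPath R n s j
  · exact ⟨s, by simp, funext hall⟩
  push Not at hall
  obtain ⟨j, hj⟩ := hall
  have hyj : y j = 3 := by
    by_contra h3
    exact hj (hin j (by have := hy3 j; omega))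
  obtain ⟨δ, hδ, hδj, hδi⟩ := route_eq_three_unique (pathNode_valid R n s).1
    (pathNode_valid R n s).2 hyj
  have hidx : boxIndex (2 * n) (limitPath R t) = boxPath R n s + δ := by
    funext i
    by_cases hij : i = j
    · subst hij
      rw [Pi.add_apply, hδj, hfl]
      have h1 := hx i
      rw [hyj] at h1
      push_cast at h1
      have h2 : ¬ (4 ^ n * limitPath R t i < (boxPath R n s i : ℝ) + 1) := fun hlt =>
        hj (by rw [hfl, Int.floor_eq_iff]; exact ⟨h1.1, hlt⟩)
      rw [Int.floor_eq_iff]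
      push_cast
      constructor <;> linarith [h1.2]
    · rw [Pi.add_apply, (hδi i hij).1, add_zero]
      exact hin i (hδi i hij).2
  rcases hδ with rfl | rfl
  · refine ⟨s - 1, by simp, ?_⟩
    rw [hidx]
    change _ + -(boxPath R n s - boxPath R n (s - 1)) = _
    abel
  · refine ⟨s + 1, by simp, ?_⟩
    rw [hidx]
    change _ + (boxPath R n (s + 1) - boxPath R n s) = _
    abel

/-- A set contains an unbounded path if it contains all points which lie, at every scale, in a box
of the path that descends from a bounded part of the axis. -/
theorem containsUnboundedPath_of_boxPath (R : Rule d) {S : Set (EuclideanSpace ℝ (Fin d))}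
    (h : ∀ x, (∃ s : ℤ, ∀ n, ∃ u : ℤ, |u / 9 ^ n - s| ≤ 1 ∧
      boxIndex (2 * n) x = boxPath R n u) → x ∈ S) :
    ContainsUnboundedPath S := by
  refine ⟨fun t => limitPath R t, (continuous_limitPath R).comp NNReal.continuous_coe, ?_,
    fun t => h _ ⟨⌊(t : ℝ)⌋, fun n => ?_⟩⟩
  -- The unit boxes run along axis `0`, so that coordinate of the limit is at least `⌊t⌋`.
  · have hle : ∀ t : NNReal, (t : ℝ) - 1 ≤ ‖limitPath R t‖ := by
      intro t
      have h0 := (limitPath_mem R t 0 0).1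
      simp only [pow_zero, one_mul, boxPath, Pi.single_eq_same] at h0
      have h1 := PiLp.norm_apply_le (limitPath R t) (0 : Fin d)
      have h2 := Int.lt_floor_add_one (t : ℝ)
      have h3 := le_abs_self (limitPath R t 0)
      rw [Real.norm_eq_abs] at h1
      linarith
    refine tendsto_atTop_mono hle ?_
    exact tendsto_atTop_add_const_right _ (-1) (NNReal.tendsto_coe_atTop.2 tendsto_id)
  · obtain ⟨u, hu, hx⟩ := boxIndex_limitPath R t n
    refine ⟨u, ?_, hx⟩
    rw [← floor_pow_div (t : ℝ) n]
    set v := ⌊(9 : ℝ) ^ n * t⌋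
    have h9 : (1 : ℤ) ≤ 9 ^ n := one_le_pow₀ (by norm_num)
    rw [abs_le] at hu ⊢
    have e1 : u / 9 ^ n ≤ (v + 1 * 9 ^ n) / 9 ^ n := Int.ediv_le_ediv (by omega) (by omega)
    have e2 : (v + (-1) * 9 ^ n) / 9 ^ n ≤ u / 9 ^ n := Int.ediv_le_ediv (by omega) (by omega)
    rw [Int.add_mul_ediv_right _ _ (by omega)] at e1 e2
    omega

end Path

/-! ### Rich subboxes, failures, and weights of lines of descendants. -/

open scoped ENNReal

/-- Both the box `v` of side `4 ^ (-(n + 1))` and its parent carry a value of at least `H`. -/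
def IsRich (a : ℕ × (Fin d → ℤ) → ℝ) (H : ℝ) (n : ℕ) (v : Fin d → ℤ) : Prop :=
  H ≤ a (2 * n + 2, v) ∧ H ≤ a (2 * n + 1, fun j => v j / 2)

/-- The total amount by which the values of `v` and of its parent fall short of `H`. -/
def deficit (a : ℕ × (Fin d → ℤ) → ℝ) (H : ℝ) (n : ℕ) (v : Fin d → ℤ) : ℝ :=
  max (H - a (2 * n + 2, v)) 0 + max (H - a (2 * n + 1, fun j => v j / 2)) 0

theorem IsRich.deficit_eq_zero {a : ℕ × (Fin d → ℤ) → ℝ} {H : ℝ} {n : ℕ} {v : Fin d → ℤ}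
    (h : IsRich a H n v) : deficit a H n v = 0 := by
  rw [deficit, max_eq_right (sub_nonpos.2 h.1), max_eq_right (sub_nonpos.2 h.2), add_zero]

/-- The two subboxes at which the path crosses from `B` to `B + δ` are rich. -/
def EdgeRich (a : ℕ × (Fin d → ℤ) → ℝ) (H : ℝ) (n : ℕ) (B δ : Fin d → ℤ) (k : Fin d) : Prop :=
  IsRich a H n ((4 : ℤ) • B + port δ k) ∧ IsRich a H n ((4 : ℤ) • (B + δ) + port (-δ) k)

/-- The subboxes strictly between the first and the last one of a node are rich. -/
def MidRich (a : ℕ × (Fin d → ℤ) → ℝ) (H : ℝ) (n : ℕ) (σ : Node d) (k₁ k₂ m : Fin d) : Prop :=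
  ∀ r ∈ Finset.Icc 1 7, IsRich a H n (σ.next k₁ k₂ m r).box

/-- The values inside a node do not permit a refinement by rich subboxes. -/
def Fails (a : ℕ × (Fin d → ℤ) → ℝ) (H : ℝ) (n : ℕ) (σ : Node d) : Prop :=
  (∀ k, ¬ EdgeRich a H n (σ.box - σ.inc) σ.inc k) ∨ (∀ k, ¬ EdgeRich a H n σ.box σ.out k) ∨
    ∃ k₁ k₂, ∀ m, ¬ MidRich a H n σ k₁ k₂ m

/-- The rule that chooses rich subboxes wherever this is possible. -/
def richRule [NeZero d] (a : ℕ × (Fin d → ℤ) → ℝ) (H : ℝ) : Rule d where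
  edge n B δ := Classical.epsilon (EdgeRich a H n B δ)
  mid n σ k₁ k₂ := Classical.epsilon (MidRich a H n σ k₁ k₂)

theorem deficit_child_eq_zero [NeZero d] {a : ℕ × (Fin d → ℤ) → ℝ} {H : ℝ} {n : ℕ} {σ : Node d}
    (h : ¬ Fails a H n σ) {r : ℕ} (hr : r < 9) :
    deficit a H n ((richRule a H).child n σ r).box = 0 := by
  simp only [Fails, not_or, not_forall, not_not, not_exists] at h
  obtain ⟨h₁, h₂, h₃⟩ := h
  have e₁ : EdgeRich a H n (σ.box - σ.inc) σ.inc ((richRule a H).edgeIn n σ) :=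
    Classical.epsilon_spec h₁
  have e₂ : EdgeRich a H n σ.box σ.out ((richRule a H).edgeOut n σ) :=
    Classical.epsilon_spec h₂
  have e₃ := Classical.epsilon_spec (h₃ ((richRule a H).edgeIn n σ) ((richRule a H).edgeOut n σ))
  apply IsRich.deficit_eq_zero
  by_cases h0 : r = 0
  · subst h0
    have := e₁.2
    rw [sub_add_cancel] at this
    exact this
  by_cases h8 : r = 8
  · subst h8
    exact e₂.1
  exact e₃ r (Finset.mem_Icc.2 ⟨by omega, by omega⟩)

/-- The factor of the child `(k₁, k₂, m, r)` of a node in an exponential moment of the deficits. -/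
def deficitWeight (a : ℕ × (Fin d → ℤ) → ℝ) (H c : ℝ) (n : ℕ) (σ : Node d)
    (l : Fin d × Fin d × Fin d × Fin 9) : ℝ≥0∞ :=
  1 + {b | Fails b H n σ}.indicator (fun b => ENNReal.ofReal
    (Real.exp (c * deficit b H n (σ.next l.1 l.2.1 l.2.2.1 l.2.2.2).box))) a

/-- The sum of the products of the weights over all conceivable lines of `N` descendants of a
node. -/
def weightSum (a : ℕ × (Fin d → ℤ) → ℝ) (H c : ℝ) : ℕ → ℕ → Node d → ℝ≥0∞
  | 0, _, _ => 1
  | N + 1, n, σ => ∑ l : Fin d × Fin d × Fin d × Fin 9, deficitWeight a H c n σ l *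
      weightSum a H c N (n + 1) (σ.next l.1 l.2.1 l.2.2.1 l.2.2.2)

/-- The line that the rule actually follows is one of the summands. Each of its exponential factors
is at most the weight, since the deficit vanishes unless the node fails. -/
theorem exp_deficit_le_weightSum [NeZero d] (a : ℕ × (Fin d → ℤ) → ℝ) (H c : ℝ) (w : ℕ → ℤ)
    (N n : ℕ) (hw : ∀ j < n + N, w j = w (j + 1) / 9) :
    ENNReal.ofReal (Real.exp (c * ∑ j ∈ Finset.range N,
      deficit a H (n + j) (boxPath (richRule a H) (n + j + 1) (w (n + j + 1)))))
      ≤ weightSum a H c N n (pathNode (richRule a H) n (w n)) := by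
  induction N generalizing n with
  | zero => simp [weightSum]
  | succ N ih =>
    set R := richRule a H with hR
    set σ := pathNode R n (w n) with hσ
    have hr : (w (n + 1) % 9).toNat < 9 := by omega
    set k₁ := R.edgeIn n σ with hk₁
    set k₂ := R.edgeOut n σ with hk₂
    have hnode : pathNode R (n + 1) (w (n + 1)) = R.child n σ (w (n + 1) % 9).toNat := by
      have h : w (n + 1) = 9 * w n + ((w (n + 1) % 9).toNat : ℕ) := by
        have := hw n (by omega)
        omega
      conv_lhs => rw [h]
      exact pathNode_succ R n _ _ hr
    rw [weightSum, Finset.sum_range_succ', mul_add, Real.exp_add, ENNReal.ofReal_mul (by positivity),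
      mul_comm]
    refine le_trans (mul_le_mul' (b := deficitWeight a H c n σ (k₁, k₂, R.mid n σ k₁ k₂, ⟨_, hr⟩))
      (d := weightSum a H c N (n + 1) (pathNode R (n + 1) (w (n + 1)))) ?_ ?_) ?_
    · have hbox : boxPath R (n + 0 + 1) (w (n + 0 + 1)) =
          (R.child n σ (w (n + 1) % 9).toNat).box := by
        rw [← hnode]
        rfl
      rw [hbox, add_zero, deficitWeight]
      by_cases hf : Fails a H n σ
      · rw [Set.indicator_of_mem (by exact hf)]
        exact le_add_self
      · rw [deficit_child_eq_zero hf hr]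
        simp
    · have h := ih (n + 1) (fun j hj => hw j (by omega))
      refine le_trans (le_of_eq ?_) h
      congr 3
      refine Finset.sum_congr rfl fun j _ => ?_
      rw [show n + (j + 1) = n + 1 + j by ring]
    · rw [hnode]
      exact Finset.single_le_sum (f := fun l : Fin d × Fin d × Fin d × Fin 9 =>
        deficitWeight a H c n σ l * weightSum a H c N (n + 1) (σ.next l.1 l.2.1 l.2.2.1 l.2.2.2))
        (fun _ _ => bot_le) (Finset.mem_univ (k₁, k₂, R.mid n σ k₁ k₂, (⟨_, hr⟩ : Fin 9)))

/-! ### From small total deficits to thick points. -/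

theorem boxIndex_succ_div (j : ℕ) (x : EuclideanSpace ℝ (Fin d)) (i : Fin d) :
    boxIndex (j + 1) x i / 2 = boxIndex j x i := by
  have h : (2 : ℝ) ^ j * x i = 2 ^ (j + 1) * x i / (2 : ℕ) := by push_cast; ring
  rw [boxIndex, boxIndex, h, Int.floor_div_natCast]
  rfl

theorem sum_range_two_mul (g : ℕ → ℝ) (N : ℕ) :
    ∑ i ∈ Finset.range (2 * N), g i = ∑ j ∈ Finset.range N, (g (2 * j) + g (2 * j + 1)) := by
  induction N with
  | zero => simp
  | succ N ih =>
    rw [show 2 * (N + 1) = 2 * N + 1 + 1 by ring, Finset.sum_range_succ, Finset.sum_range_succ, ih,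
      Finset.sum_range_succ, add_assoc]

theorem mem_thickPoints_of_deficit [NeZero d] {a : ℕ × (Fin d → ℤ) → ℝ} {α : ℝ} {R : Rule d}
    (h : ∀ s : ℤ, ∀ᶠ N : ℕ in atTop, ∀ u : ℤ, u / 9 ^ N = s → ∑ j ∈ Finset.range N,
      deficit a (α + 2) j (boxPath R (j + 1) (u / 9 ^ (N - (j + 1)))) ≤ N)
    {x : EuclideanSpace ℝ (Fin d)} {s : ℤ}
    (hx : ∀ n, ∃ u : ℤ, |u / 9 ^ n - s| ≤ 1 ∧ boxIndex (2 * n) x = boxPath R n u) :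
    x ∈ thickPoints a α := by
  have hev : ∀ᶠ N : ℕ in atTop, ∀ u : ℤ, |u / 9 ^ N - s| ≤ 1 → ∑ j ∈ Finset.range N,
      deficit a (α + 2) j (boxPath R (j + 1) (u / 9 ^ (N - (j + 1)))) ≤ N := by
    filter_upwards [h (s - 1), h s, h (s + 1)] with N h₁ h₂ h₃ u hu
    have : u / 9 ^ N = s - 1 ∨ u / 9 ^ N = s ∨ u / 9 ^ N = s + 1 := by
      rw [abs_le] at hu
      omega
    rcases this with h | h | h
    exacts [h₁ u h, h₂ u h, h₃ u h]
  set f : ℕ → ℝ := fun i => a (i, boxIndex i x) with hf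
  have hdef : ∀ᶠ N : ℕ in atTop,
      ∑ i ∈ Finset.range (2 * N), max (α + 2 - f (i + 1)) 0 ≤ N := by
    filter_upwards [hev] with N hN
    obtain ⟨u, hu, hxu⟩ := hx N
    refine le_trans (le_of_eq ?_) (hN u hu)
    -- The times supplied by `hx` at different scales need not be compatible; the one at scale `N`
    -- is kept and its ancestors are used at all coarser scales.
    have hbox : ∀ i ≤ N, boxIndex (2 * (N - i)) x = boxPath R (N - i) (u / 9 ^ i) := by
      intro i
      induction i with
      | zero => intro; simpa using hxu
      | succ i ih =>
        intro hi
        have e : N - i = N - (i + 1) + 1 := by omega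
        have h1 := ih (by omega)
        rw [e] at h1
        funext j
        have h2 := congrFun h1 j
        rw [← boxIndex_succ_div, ← boxIndex_succ_div,
          show 2 * (N - (i + 1)) + 1 + 1 = 2 * (N - (i + 1) + 1) by ring, h2,
          Int.ediv_ediv_of_nonneg (by norm_num)]
        rw [show (2 : ℤ) * 2 = 4 by norm_num, boxPath_div, Int.ediv_ediv_of_nonneg (by positivity),
          pow_succ]
    rw [sum_range_two_mul]
    refine Finset.sum_congr rfl fun j hj => ?_
    have hjN := Finset.mem_range.1 hj
    have e1 := hbox (N - (j + 1)) (by omega)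
    rw [show N - (N - (j + 1)) = j + 1 by omega] at e1
    rw [deficit, ← e1, add_comm]
    have e2 : (fun i => boxIndex (2 * (j + 1)) x i / 2) = boxIndex (2 * j + 1) x := by
      funext i
      exact boxIndex_succ_div (2 * j + 1) x i
    rw [e2]
    rfl
  have hhalf : Tendsto (fun l : ℕ => (l + 1) / 2) atTop atTop := by
    refine tendsto_atTop.2 fun b => ?_
    filter_upwards [eventually_ge_atTop (2 * b)] with l hl
    omega
  obtain ⟨l₀, hl₀⟩ := exists_nat_ge (-f 0)
  rw [thickPoints, Set.mem_ofPred_eq]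
  refine le_liminf_of_le (by isBoundedDefault) ?_
  filter_upwards [hhalf.eventually hdef, eventually_ge_atTop 1, eventually_ge_atTop l₀]
    with l hl h1 hl0
  rw [EReal.coe_le_coe_iff, le_div_iff₀ (by exact_mod_cast h1)]
  have hN : (((l + 1) / 2 : ℕ) : ℝ) ≤ l := by exact_mod_cast (by omega : (l + 1) / 2 ≤ l)
  have hl0' : (l₀ : ℝ) ≤ l := by exact_mod_cast hl0
  have hsub : ∑ i ∈ Finset.range l, max (α + 2 - f (i + 1)) 0
      ≤ ∑ i ∈ Finset.range (2 * ((l + 1) / 2)), max (α + 2 - f (i + 1)) 0 :=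
    Finset.sum_le_sum_of_subset_of_nonneg (Finset.range_mono (by omega))
      fun _ _ _ => le_max_right _ _
  have hlow : (l : ℝ) * (α + 2) - ∑ i ∈ Finset.range l, max (α + 2 - f (i + 1)) 0
      ≤ ∑ i ∈ Finset.range l, f (i + 1) := by
    have : ∑ i ∈ Finset.range l, (α + 2 - max (α + 2 - f (i + 1)) 0)
        ≤ ∑ i ∈ Finset.range l, f (i + 1) :=
      Finset.sum_le_sum fun i _ => by linarith [le_max_left (α + 2 - f (i + 1)) 0]
    rw [Finset.sum_sub_distrib, Finset.sum_const, Finset.card_range, nsmul_eq_mul] at this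
    exact this
  have hwalk : walk a l x = ∑ i ∈ Finset.range l, f (i + 1) + f 0 := Finset.sum_range_succ' f l
  rw [hwalk]
  -- Of the surplus `2 * l`, one `l` absorbs the deficits and the other absorbs the level-0 value `f
  -- 0`, which no deficit accounts for.
  linarith

/-! ### Independence and the probability of failure. -/

/-- The sigma-algebra generated by the variables with index in `S`. -/
abbrev sigmaOf {ι Ω : Type*} (a : ι → Ω → ℝ) (S : Set ι) : MeasurableSpace Ω :=
  ⨆ p ∈ S, MeasurableSpace.comap (a p) inferInstance

theorem measurable_sigmaOf {ι Ω : Type*} (a : ι → Ω → ℝ) {S : Set ι} {p : ι} (hp : p ∈ S) :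
    Measurable[sigmaOf a S] (a p) :=
  (comap_measurable (a p)).mono (le_iSup₂_of_le p hp le_rfl) le_rfl

theorem sigmaOf_le {ι Ω : Type*} {m : MeasurableSpace Ω} {a : ι → Ω → ℝ} (ha : ∀ p, Measurable (a p))
    (S : Set ι) : sigmaOf a S ≤ m :=
  iSup₂_le fun p _ => (ha p).comap_le

theorem indep_sigmaOf {ι Ω : Type*} {m : MeasurableSpace Ω} {P : Measure Ω} {a : ι → Ω → ℝ}
    (ha : ∀ p, Measurable (a p)) (hind : iIndepFun a P) {S T : Set ι} (h : Disjoint S T) :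
    Indep (sigmaOf a S) (sigmaOf a T) P :=
  indep_iSup_of_disjoint (fun p => (ha p).comap_le) hind h

/-- Among disjoint groups of at most `c` independent variables, the probability that every group
contains a value below `H` decays exponentially in the number of groups. -/
theorem measure_forall_exists_lt_le {ι κ Ω : Type*} [MeasurableSpace Ω] {P : Measure Ω}
    [IsProbabilityMeasure P] {a : ι → Ω → ℝ} (ha : ∀ p, Measurable (a p)) (hind : iIndepFun a P)
    {H : ℝ} {q : ℝ≥0∞} (hq : ∀ p, P {ω | H ≤ a p ω} = q) {c : ℕ} (V : κ → Finset ι)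
    (K : Finset κ) (hV : ∀ k ∈ K, (V k).card ≤ c)
    (hdisj : ∀ k ∈ K, ∀ k' ∈ K, k ≠ k' → Disjoint (V k) (V k')) :
    P {ω | ∀ k ∈ K, ∃ p ∈ V k, a p ω < H} ≤ (1 - q ^ c) ^ K.card := by
  classical
  have hgroup : ∀ (S : Set ι) (V : Finset ι), (∀ p ∈ V, p ∈ S) →
      MeasurableSet[sigmaOf a S] {ω | ∃ p ∈ V, a p ω < H} := by
    intro S V hS
    have : {ω | ∃ p ∈ V, a p ω < H} = ⋃ p ∈ V, {ω | a p ω < H} := by ext; simp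
    rw [this]
    exact Finset.measurableSet_biUnion _ fun p hp =>
      measurable_sigmaOf a (hS p hp) measurableSet_Iio
  have hsingle : ∀ V : Finset ι, V.card ≤ c → P {ω | ∃ p ∈ V, a p ω < H} ≤ 1 - q ^ c := by
    intro V hVc
    have hall : P (⋂ p ∈ V, a p ⁻¹' Set.Ici H) = q ^ V.card := by
      rw [hind.measure_inter_preimage_eq_mul V (fun _ _ => measurableSet_Ici)]
      exact Finset.prod_eq_pow_card fun p _ => hq p
    have hcompl : {ω | ∃ p ∈ V, a p ω < H} = (⋂ p ∈ V, a p ⁻¹' Set.Ici H)ᶜ := by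
      ext
      simp
    -- The bound `q ≤ 1` comes from some variable `a p`, so an empty group is treated separately.
    have hq1 : q ≤ 1 ∨ V.card = 0 := by
      rcases V.eq_empty_or_nonempty with rfl | ⟨p, _⟩
      · exact Or.inr rfl
      · exact Or.inl (hq p ▸ prob_le_one)
    rw [hcompl, prob_compl_eq_one_sub
      (Finset.measurableSet_biInter _ fun p _ => ha p measurableSet_Ici), hall]
    rcases hq1 with hq1 | h0
    · exact tsub_le_tsub_left (pow_le_pow_right_of_le_one' hq1 hVc) 1
    · simp [h0]
  induction K using Finset.induction_on with
  | empty => simp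
  | insert k K hk ih =>
    have hset : {ω | ∀ k' ∈ insert k K, ∃ p ∈ V k', a p ω < H}
        = {ω | ∃ p ∈ V k, a p ω < H} ∩ {ω | ∀ k' ∈ K, ∃ p ∈ V k', a p ω < H} := by
      ext
      simp
    have hdis : Disjoint (V k : Set ι) (⋃ k' ∈ K, (V k' : Set ι)) := by
      rw [Set.disjoint_iUnion₂_right]
      intro k' hk'
      exact Finset.disjoint_coe.2 (hdisj k (Finset.mem_insert_self _ _) k'
        (Finset.mem_insert_of_mem hk') (fun h => hk (h ▸ hk')))
    have hm : MeasurableSet[sigmaOf a (⋃ k' ∈ K, (V k' : Set ι))]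
        {ω | ∀ k' ∈ K, ∃ p ∈ V k', a p ω < H} := by
      have : {ω | ∀ k' ∈ K, ∃ p ∈ V k', a p ω < H} = ⋂ k' ∈ K, {ω | ∃ p ∈ V k', a p ω < H} := by
        ext
        simp
      rw [this]
      exact Finset.measurableSet_biInter _ fun k' hk' =>
        hgroup _ _ fun p hp => Set.mem_iUnion₂.2 ⟨k', hk', hp⟩
    rw [hset, (Indep_iff _ _ _).1 (indep_sigmaOf ha hind hdis) _ _
      (hgroup _ _ fun p hp => hp) hm, Finset.card_insert_of_notMem hk, pow_succ, mul_comm]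
    exact mul_le_mul' (ih (fun k' hk' => hV k' (Finset.mem_insert_of_mem hk'))
      fun k₁ h₁ k₂ h₂ => hdisj k₁ (Finset.mem_insert_of_mem h₁) k₂ (Finset.mem_insert_of_mem h₂))
      (hsingle _ (hV k (Finset.mem_insert_self _ _)))

section Fails

variable {Ω : Type*} [MeasurableSpace Ω] {P : Measure Ω} [IsProbabilityMeasure P]
  {a : ℕ × (Fin d → ℤ) → Ω → ℝ}

/-- The digits 1 and 2 have different halves, so the groups for distinct `k` are disjoint at the
parent level too. Seven boxes on two levels give the exponent 14. -/
theorem measure_forall_exists_not_isRich_le (ha : ∀ p, Measurable (a p)) (hind : iIndepFun a P)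
    {H : ℝ} {q : ℝ≥0∞} (hq : ∀ p, P {ω | H ≤ a p ω} = q) (n : ℕ)
    (V : Fin d → Finset (Fin d → ℤ)) (K : Finset (Fin d)) (hcard : ∀ k, (V k).card ≤ 7)
    (hV : ∀ k ∈ K, ∀ v ∈ V k, v k % 4 = 2 ∧ ∀ k' ∈ K, k' ≠ k → v k' % 4 = 1) :
    P {ω | ∀ k ∈ K, ∃ v ∈ V k, ¬ IsRich (fun p => a p ω) H n v} ≤ (1 - q ^ 14) ^ K.card := by
  classical
  set W : Fin d → Finset (ℕ × (Fin d → ℤ)) := fun k =>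
    (V k).image (fun v => (2 * n + 2, v)) ∪
      (V k).image (fun v => (2 * n + 1, fun j => v j / 2)) with hW
  refine le_trans (measure_mono ?_) (measure_forall_exists_lt_le ha hind hq W K (c := 14) ?_ ?_)
  · intro ω hω k hk
    obtain ⟨v, hv, hrich⟩ := hω k hk
    simp only [IsRich, not_and_or, not_le] at hrich
    rcases hrich with h | h
    · exact ⟨_, Finset.mem_union_left _ (Finset.mem_image_of_mem _ hv), h⟩
    · exact ⟨_, Finset.mem_union_right _ (Finset.mem_image_of_mem _ hv), h⟩
  · intro k _
    refine (Finset.card_union_le _ _).trans ?_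
    exact (add_le_add (Finset.card_image_le.trans (hcard k))
      (Finset.card_image_le.trans (hcard k)))
  · intro k hk k' hk' hne
    rw [Finset.disjoint_left]
    intro p hp hp'
    simp only [hW, Finset.mem_union, Finset.mem_image] at hp hp'
    rcases hp with ⟨v, hv, rfl⟩ | ⟨v, hv, rfl⟩ <;> rcases hp' with ⟨v', hv', h⟩ | ⟨v', hv', h⟩ <;>
      rw [Prod.mk.injEq] at h
    · have h1 := (hV k hk v hv).1
      have h2 := (hV k' hk' v' hv').2 k hk hne
      rw [h.2] at h2
      omega
    · omega
    · omega
    · have h1 := (hV k hk v hv).1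
      have h2 := (hV k' hk' v' hv').2 k hk hne
      have h3 := congrFun h.2 k
      omega

theorem measure_forall_not_edgeRich_le (ha : ∀ p, Measurable (a p)) (hind : iIndepFun a P)
    {H : ℝ} {q : ℝ≥0∞} (hq : ∀ p, P {ω | H ≤ a p ω} = q) (n : ℕ) (B : Fin d → ℤ)
    {δ : Fin d → ℤ} (hδ : IsStep δ) :
    P {ω | ∀ k, ¬ EdgeRich (fun p => a p ω) H n B δ k} ≤ (1 - q ^ 14) ^ (d - 4) := by
  classical
  obtain ⟨i, -, hi⟩ := hδ
  set V : Fin d → Finset (Fin d → ℤ) := fun k =>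
    {(4 : ℤ) • B + port δ k, (4 : ℤ) • (B + δ) + port (-δ) k} with hV
  refine le_trans (measure_mono ?_) ((measure_forall_exists_not_isRich_le ha hind hq n V
    (Finset.univ \ {i}) ?_ ?_).trans (pow_le_pow_right_of_le_one' tsub_le_self ?_))
  · intro ω hω k _
    have h := hω k
    rw [EdgeRich, not_and_or] at h
    rcases h with h | h
    · exact ⟨_, by simp [hV], h⟩
    · exact ⟨_, by simp [hV], h⟩
  · intro k
    exact Finset.card_le_two.trans (by norm_num)
  · intro k hk v hv
    have h0 : ∀ k ∈ Finset.univ \ ({i} : Finset (Fin d)), δ k = 0 := fun k hk =>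
      hi k (by simpa using hk)
    have hval : ∀ k' ∈ Finset.univ \ ({i} : Finset (Fin d)),
        v k' % 4 = if k' = k then 2 else 1 := by
      intro k' hk'
      simp only [hV, Finset.mem_insert, Finset.mem_singleton] at hv
      have hp : port δ k k' = if k' = k then 2 else 1 := by simp [port, faceDigit, h0 k' hk']
      have hn : port (-δ) k k' = if k' = k then 2 else 1 := by simp [port, faceDigit, h0 k' hk']
      rcases hv with rfl | rfl
      · simp only [Pi.add_apply, Pi.smul_apply, smul_eq_mul, hp]
        split_ifs <;> omega
      · simp only [Pi.add_apply, Pi.smul_apply, smul_eq_mul, hn]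
        split_ifs <;> omega
    exact ⟨by simpa using hval k hk, fun k' hk' hne => by simpa [hne] using hval k' hk'⟩
  · have := Finset.le_card_sdiff ({i} : Finset (Fin d)) Finset.univ
    rw [Finset.card_singleton, Finset.card_univ, Fintype.card_fin] at this
    omega

theorem measure_forall_not_midRich_le (ha : ∀ p, Measurable (a p)) (hind : iIndepFun a P)
    {H : ℝ} {q : ℝ≥0∞} (hq : ∀ p, P {ω | H ≤ a p ω} = q) (n : ℕ) {σ : Node d} (hσ : σ.Valid)
    (k₁ k₂ : Fin d) :
    P {ω | ∀ m, ¬ MidRich (fun p => a p ω) H n σ k₁ k₂ m} ≤ (1 - q ^ 14) ^ (d - 4) := by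
  classical
  obtain ⟨⟨i₁, -, hi₁⟩, ⟨i₂, -, hi₂⟩⟩ := hσ
  set V : Fin d → Finset (Fin d → ℤ) := fun m =>
    (Finset.Icc 1 7).image fun r => (σ.next k₁ k₂ m r).box with hV
  set E : Finset (Fin d) := {k₁, k₂, i₁, i₂} with hE
  refine le_trans (measure_mono ?_) ((measure_forall_exists_not_isRich_le ha hind hq n V
    (Finset.univ \ E) ?_ ?_).trans (pow_le_pow_right_of_le_one' tsub_le_self ?_))
  · intro ω hω m _
    have h := hω m
    simp only [MidRich, not_forall] at h
    obtain ⟨r, hr, h⟩ := h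
    exact ⟨_, Finset.mem_image_of_mem _ hr, h⟩
  · intro k
    exact Finset.card_image_le.trans (by simp)
  · intro m hm v hv
    have hval : ∀ k ∈ Finset.univ \ E, v k % 4 = if k = m then 2 else 1 := by
      intro k hk
      simp only [hE, Finset.mem_sdiff, Finset.mem_univ, Finset.mem_insert, Finset.mem_singleton,
        true_and, not_or] at hk
      obtain ⟨h1, h2, h3, h4⟩ := hk
      simp only [hV, Finset.mem_image] at hv
      obtain ⟨r, hr, rfl⟩ := hv
      rw [Finset.mem_Icc] at hr
      have hroute : route σ.inc σ.out k₁ k₂ m r k = if k = m then 2 else 1 := by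
        obtain ⟨hr1, hr7⟩ := hr
        interval_cases r <;>
          simp [route, faceDigit, nearDigit, hi₁ k h3, hi₂ k h4, h1, h2]
      simp only [Node.next, Pi.add_apply, Pi.smul_apply, smul_eq_mul, hroute]
      split_ifs <;> omega
    exact ⟨by simpa using hval m hm, fun k' hk' hne => by simpa [hne] using hval k' hk'⟩
  · have h1 := Finset.le_card_sdiff E Finset.univ
    rw [Finset.card_univ, Fintype.card_fin] at h1
    have h2 : E.card ≤ 4 := Finset.card_le_four
    omega

/-- A union bound over two crossings and all `d ^ 2` pairs `(k₁, k₂)`; covering all pairs avoids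
conditioning on the pair that the rule selects. -/
theorem measure_fails_le (ha : ∀ p, Measurable (a p)) (hind : iIndepFun a P)
    {H : ℝ} {q : ℝ≥0∞} (hq : ∀ p, P {ω | H ≤ a p ω} = q) (n : ℕ) {σ : Node d} (hσ : σ.Valid) :
    P {ω | Fails (fun p => a p ω) H n σ} ≤ (2 + (d : ℝ≥0∞) ^ 2) * (1 - q ^ 14) ^ (d - 4) := by
  have hsub : {ω | Fails (fun p => a p ω) H n σ} ⊆
      {ω | ∀ k, ¬ EdgeRich (fun p => a p ω) H n (σ.box - σ.inc) σ.inc k} ∪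
      ({ω | ∀ k, ¬ EdgeRich (fun p => a p ω) H n σ.box σ.out k} ∪
      ⋃ k : Fin d × Fin d, {ω | ∀ m, ¬ MidRich (fun p => a p ω) H n σ k.1 k.2 m}) := by
    rintro ω (h | h | ⟨k₁, k₂, h⟩)
    · exact Or.inl h
    · exact Or.inr (Or.inl h)
    · exact Or.inr (Or.inr (Set.mem_iUnion.2 ⟨(k₁, k₂), h⟩))
  refine (measure_mono hsub).trans ((measure_union_le _ _).trans ((add_le_add
    (measure_forall_not_edgeRich_le ha hind hq n _ hσ.1) ((measure_union_le _ _).trans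
      (add_le_add (measure_forall_not_edgeRich_le ha hind hq n _ hσ.2)
        ((measure_iUnion_fintype_le _ _).trans (Finset.sum_le_sum fun k _ =>
          measure_forall_not_midRich_le ha hind hq n hσ k.1 k.2))))).trans (le_of_eq ?_)))
  rw [Finset.sum_const, Finset.card_univ, Fintype.card_prod, Fintype.card_fin, nsmul_eq_mul]
  push_cast
  ring

end Fails

/-! ### Measurability and exponential moments of the weights. -/

theorem measurable_deficit {Ω : Type*} [MeasurableSpace Ω] {a : ℕ × (Fin d → ℤ) → Ω → ℝ} {n : ℕ}
    (ha : ∀ p, 2 * n < p.1 → p.1 ≤ 2 * n + 2 → Measurable (a p)) (H : ℝ) (v : Fin d → ℤ) :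
    Measurable fun ω => deficit (fun p => a p ω) H n v :=
  ((measurable_const.sub (ha (2 * n + 2, v) (by simp) (by simp))).max measurable_const).add
    ((measurable_const.sub (ha (2 * n + 1, _) (by simp) (by simp))).max measurable_const)

theorem measurableSet_fails {Ω : Type*} [MeasurableSpace Ω] {a : ℕ × (Fin d → ℤ) → Ω → ℝ} {n : ℕ}
    (ha : ∀ p, 2 * n < p.1 → p.1 ≤ 2 * n + 2 → Measurable (a p)) (H : ℝ) (σ : Node d) :
    MeasurableSet {ω | Fails (fun p => a p ω) H n σ} := by
  have hrich : ∀ v, Measurable fun ω => IsRich (fun p => a p ω) H n v := fun v =>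
    (measurableSet_setOfPred.1 (measurableSet_le measurable_const
      (ha (2 * n + 2, v) (by simp) (by simp)))).and
    (measurableSet_setOfPred.1 (measurableSet_le measurable_const
      (ha (2 * n + 1, _) (by simp) (by simp))))
  have hedge : ∀ B δ k, Measurable fun ω => EdgeRich (fun p => a p ω) H n B δ k :=
    fun B δ k => (hrich _).and (hrich _)
  have hmid : ∀ k₁ k₂ m, Measurable fun ω => MidRich (fun p => a p ω) H n σ k₁ k₂ m :=
    fun k₁ k₂ m => Measurable.forall fun r => Measurable.forall fun _ => hrich _
  refine measurableSet_setOfPred.2 ((Measurable.forall fun k => (hedge _ _ k).not).or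
    ((Measurable.forall fun k => (hedge _ _ k).not).or ?_))
  exact Measurable.exists fun k₁ => Measurable.exists fun k₂ => Measurable.forall fun m =>
    (hmid k₁ k₂ m).not

theorem measurable_deficitWeight {Ω : Type*} [MeasurableSpace Ω] {a : ℕ × (Fin d → ℤ) → Ω → ℝ}
    {n : ℕ} (ha : ∀ p, 2 * n < p.1 → p.1 ≤ 2 * n + 2 → Measurable (a p)) (H c : ℝ) (σ : Node d)
    (l : Fin d × Fin d × Fin d × Fin 9) :
    Measurable fun ω => deficitWeight (fun p => a p ω) H c n σ l :=
  measurable_const.add (((measurable_deficit ha H _).const_mul c).exp.ennreal_ofReal.indicator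
    (measurableSet_fails ha H σ))

theorem measurable_weightSum {Ω : Type*} [MeasurableSpace Ω] {a : ℕ × (Fin d → ℤ) → Ω → ℝ}
    (N n : ℕ) (ha : ∀ p, 2 * n < p.1 → Measurable (a p)) (H c : ℝ) (σ : Node d) :
    Measurable fun ω => weightSum (fun p => a p ω) H c N n σ := by
  induction N generalizing n σ with
  | zero => exact measurable_const
  | succ N ih =>
    exact Finset.measurable_sum _ fun l _ =>
      (measurable_deficitWeight (fun p hp _ => ha p hp) H c σ l).mul
        (ih (n + 1) (fun p hp => ha p (by omega)) _)

/-- A bound for the exponential moment of order `2 * c` of the deficit of a box. -/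
def momentBound (H c : ℝ) : ℝ := 1 + Real.exp (4 * c * H + 8 * c ^ 2 * Real.log 2)

theorem lintegral_exp_mul_sub {Ω : Type*} [MeasurableSpace Ω] {P : Measure Ω} {X : Ω → ℝ}
    (hX : HasLaw X (gaussianReal 0 (Real.log 2).toNNReal) P) (H c : ℝ) :
    ∫⁻ ω, ENNReal.ofReal (Real.exp (4 * c * (H - X ω))) ∂P
      = ENNReal.ofReal (Real.exp (4 * c * H + 8 * c ^ 2 * Real.log 2)) := by
  have hint : Integrable (fun x => Real.exp (-4 * c * x)) (gaussianReal 0 (Real.log 2).toNNReal) :=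
    integrable_exp_mul_gaussianReal _
  have hmgf : ∫ x, Real.exp (-4 * c * x) ∂(gaussianReal 0 (Real.log 2).toNNReal)
      = Real.exp (8 * c ^ 2 * Real.log 2) := by
    have h := congrFun (mgf_id_gaussianReal (μ := 0) (v := (Real.log 2).toNNReal)) (-4 * c)
    rw [mgf] at h
    simp only [id_eq] at h
    rw [h, Real.coe_toNNReal _ (Real.log_nonneg (by norm_num))]
    congr 1
    ring
  have hlaw : ∫⁻ ω, ENNReal.ofReal (Real.exp (4 * c * (H - X ω))) ∂P
      = ∫⁻ x, ENNReal.ofReal (Real.exp (4 * c * (H - x))) ∂(gaussianReal 0 (Real.log 2).toNNReal) := by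
    rw [← hX.map_eq, lintegral_map' (by fun_prop) hX.aemeasurable]
  have hsplit : ∀ x : ℝ, ENNReal.ofReal (Real.exp (4 * c * (H - x)))
      = ENNReal.ofReal (Real.exp (4 * c * H)) * ENNReal.ofReal (Real.exp (-4 * c * x)) := by
    intro x
    rw [← ENNReal.ofReal_mul (by positivity), ← Real.exp_add]
    ring_nf
  rw [hlaw, lintegral_congr hsplit, lintegral_const_mul _ (by fun_prop),
    ← ofReal_integral_eq_lintegral_ofReal hint (ae_of_all _ fun _ => by positivity), hmgf,
    ← ENNReal.ofReal_mul (by positivity), Real.exp_add]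

section Moments

variable {Ω : Type*} [MeasurableSpace Ω] {P : Measure Ω} [IsProbabilityMeasure P]
  {a : ℕ × (Fin d → ℤ) → Ω → ℝ}

theorem lintegral_exp_deficit_le
    (hlaw : ∀ p, HasLaw (a p) (gaussianReal 0 (Real.log 2).toNNReal) P)
    {H c : ℝ} (n : ℕ) (v : Fin d → ℤ) :
    ∫⁻ ω, ENNReal.ofReal (Real.exp (2 * (c * deficit (fun p => a p ω) H n v))) ∂P
      ≤ ENNReal.ofReal (momentBound H c) := by
  have hmax : ∀ y : ℝ, Real.exp (4 * c * max y 0) ≤ 1 + Real.exp (4 * c * y) := by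
    intro y
    rcases le_total y 0 with h | h
    · rw [max_eq_right h, mul_zero, Real.exp_zero]
      linarith [Real.exp_pos (4 * c * y)]
    · rw [max_eq_left h]
      linarith
  have hpt : ∀ x y : ℝ, Real.exp (2 * (c * (max x 0 + max y 0)))
      ≤ 1 + (1 / 2) * (Real.exp (4 * c * x) + Real.exp (4 * c * y)) := by
    intro x y
    have e1 : Real.exp (4 * c * max x 0) = Real.exp (2 * c * max x 0) ^ 2 := by
      rw [← Real.exp_nat_mul]
      congr 1
      push_cast
      ring
    have e2 : Real.exp (4 * c * max y 0) = Real.exp (2 * c * max y 0) ^ 2 := by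
      rw [← Real.exp_nat_mul]
      congr 1
      push_cast
      ring
    have e3 : Real.exp (2 * (c * (max x 0 + max y 0)))
        = Real.exp (2 * c * max x 0) * Real.exp (2 * c * max y 0) := by
      rw [← Real.exp_add]
      congr 1
      ring
    have h1 := hmax x
    have h2 := hmax y
    have h3 := sq_nonneg (Real.exp (2 * c * max x 0) - Real.exp (2 * c * max y 0))
    rw [e3]
    rw [e1] at h1
    rw [e2] at h2
    linarith
  have hmeas : ∀ p, AEMeasurable (fun ω => ENNReal.ofReal (Real.exp (4 * c * (H - a p ω)))) P :=
    fun p => (((hlaw p).aemeasurable.const_sub H).const_mul (4 * c)).exp.ennreal_ofReal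
  calc ∫⁻ ω, ENNReal.ofReal (Real.exp (2 * (c * deficit (fun p => a p ω) H n v))) ∂P
      ≤ ∫⁻ ω, (1 + ENNReal.ofReal (1 / 2) *
          (ENNReal.ofReal (Real.exp (4 * c * (H - a (2 * n + 2, v) ω))) +
            ENNReal.ofReal (Real.exp (4 * c * (H - a (2 * n + 1, fun j => v j / 2) ω))))) ∂P := by
        refine lintegral_mono fun ω => ?_
        rw [← ENNReal.ofReal_add (by positivity) (by positivity),
          ← ENNReal.ofReal_mul (by norm_num), ← ENNReal.ofReal_one,
          ← ENNReal.ofReal_add (by norm_num) (by positivity)]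
        exact ENNReal.ofReal_le_ofReal (hpt _ _)
    _ = ENNReal.ofReal (momentBound H c) := by
        rw [lintegral_add_left measurable_const, lintegral_const_mul' _ _ ENNReal.ofReal_ne_top,
          lintegral_add_left' (hmeas _), lintegral_exp_mul_sub (hlaw _),
          lintegral_exp_mul_sub (hlaw _), lintegral_const, measure_univ, mul_one,
          ← ENNReal.ofReal_add (by positivity) (by positivity),
          ← ENNReal.ofReal_mul (by norm_num), ← ENNReal.ofReal_one,
          ← ENNReal.ofReal_add (by norm_num) (by positivity), momentBound]
        congr 1
        ring

theorem lintegral_deficitWeight_le (ha : ∀ p, Measurable (a p))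
    (hlaw : ∀ p, HasLaw (a p) (gaussianReal 0 (Real.log 2).toNNReal) P)
    {H c : ℝ} {n : ℕ} {σ : Node d}
    (hfail : ENNReal.ofReal (momentBound H c) * P {ω | Fails (fun p => a p ω) H n σ} ≤ 1)
    (l : Fin d × Fin d × Fin d × Fin 9) :
    ∫⁻ ω, deficitWeight (fun p => a p ω) H c n σ l ∂P ≤ 2 := by
  set M := momentBound H c with hM
  have hM0 : 0 < M := by
    rw [hM, momentBound]
    positivity
  set F := {ω | Fails (fun p => a p ω) H n σ} with hF
  set v := (σ.next l.1 l.2.1 l.2.2.1 l.2.2.2).box with hv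
  have hFm : MeasurableSet F := measurableSet_fails (fun p _ _ => ha p) H σ
  -- On failure this is `exp z ≤ exp (2 * z) / (2 * M) + M / 2`, from `(exp z - M) ^ 2 ≥ 0`. It
  -- decouples the deficit from the failure event, and each term has mean at most `1 / 2`.
  have hpt : ∀ ω, deficitWeight (fun p => a p ω) H c n σ l ≤ 1 + (ENNReal.ofReal (1 / (2 * M)) *
      ENNReal.ofReal (Real.exp (2 * (c * deficit (fun p => a p ω) H n v))) +
      ENNReal.ofReal (M / 2) * F.indicator 1 ω) := by
    intro ω
    refine add_le_add le_rfl ?_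
    by_cases hω : Fails (fun p => a p ω) H n σ
    · rw [Set.indicator_of_mem (by exact hω), Set.indicator_of_mem (by exact hω), Pi.one_apply,
        mul_one, ← ENNReal.ofReal_mul (by positivity),
        ← ENNReal.ofReal_add (by positivity) (by positivity)]
      refine ENNReal.ofReal_le_ofReal ?_
      set z := c * deficit (fun p => a p ω) H n v
      have e : Real.exp (2 * z) = Real.exp z ^ 2 := by
        rw [← Real.exp_nat_mul]
        norm_num
      have h := sq_nonneg (Real.exp z - M)
      rw [e, one_div, ← div_eq_inv_mul, div_add_div _ _ (by positivity) (by norm_num),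
        le_div_iff₀ (by positivity)]
      nlinarith
    · rw [Set.indicator_of_notMem (by exact hω)]
      exact bot_le
  refine (lintegral_mono hpt).trans ?_
  rw [lintegral_add_left measurable_const, lintegral_add_right _
      ((measurable_one.indicator hFm).const_mul _),
    lintegral_const_mul' _ _ ENNReal.ofReal_ne_top, lintegral_const_mul' _ _ ENNReal.ofReal_ne_top,
    lintegral_indicator_one hFm, lintegral_const, measure_univ, mul_one]
  have h1 : ENNReal.ofReal (1 / (2 * M)) *
      ∫⁻ ω, ENNReal.ofReal (Real.exp (2 * (c * deficit (fun p => a p ω) H n v))) ∂P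
      ≤ ENNReal.ofReal (1 / 2) := by
    refine (mul_le_mul' le_rfl (lintegral_exp_deficit_le hlaw n v)).trans (le_of_eq ?_)
    rw [← hM, ← ENNReal.ofReal_mul (by positivity)]
    congr 1
    field_simp
  have h2 : ENNReal.ofReal (M / 2) * P F ≤ ENNReal.ofReal (1 / 2) := by
    rw [show M / 2 = 1 / 2 * M by ring, ENNReal.ofReal_mul (by norm_num), mul_assoc]
    exact (mul_le_mul' le_rfl hfail).trans (by rw [mul_one])
  refine (add_le_add le_rfl (add_le_add h1 h2)).trans (le_of_eq ?_)
  rw [← ENNReal.ofReal_add (by norm_num) (by norm_num)]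
  norm_num

/-- For a fixed node, the first weight uses only levels `2 * n + 1` and `2 * n + 2`, and the
remaining sum only later levels. By independence each generation costs a factor `2 * (9 * d ^ 3)`.
-/
theorem lintegral_weightSum_le (ha : ∀ p, Measurable (a p)) (hind : iIndepFun a P)
    (hlaw : ∀ p, HasLaw (a p) (gaussianReal 0 (Real.log 2).toNNReal) P)
    {H c : ℝ}
    (hfail : ∀ (n : ℕ) (σ : Node d), σ.Valid →
      ENNReal.ofReal (momentBound H c) * P {ω | Fails (fun p => a p ω) H n σ} ≤ 1)
    (N n : ℕ) {σ : Node d} (hσ : σ.Valid) :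
    ∫⁻ ω, weightSum (fun p => a p ω) H c N n σ ∂P ≤ (18 * (d : ℝ≥0∞) ^ 3) ^ N := by
  induction N generalizing n σ with
  | zero => simp [weightSum]
  | succ N ih =>
    simp only [weightSum]
    have hm : ∀ l : Fin d × Fin d × Fin d × Fin 9, Measurable fun ω =>
        deficitWeight (fun p => a p ω) H c n σ l *
          weightSum (fun p => a p ω) H c N (n + 1) (σ.next l.1 l.2.1 l.2.2.1 l.2.2.2) := fun l =>
      (measurable_deficitWeight (fun p _ _ => ha p) H c σ l).mul
        (measurable_weightSum N (n + 1) (fun p _ => ha p) H c _)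
    rw [lintegral_finsetSum _ fun l _ => hm l]
    have hterm : ∀ l : Fin d × Fin d × Fin d × Fin 9,
        ∫⁻ ω, deficitWeight (fun p => a p ω) H c n σ l *
          weightSum (fun p => a p ω) H c N (n + 1) (σ.next l.1 l.2.1 l.2.2.1 l.2.2.2) ∂P
          ≤ 2 * (18 * (d : ℝ≥0∞) ^ 3) ^ N := by
      intro l
      set S : Set (ℕ × (Fin d → ℤ)) := {p | 2 * n < p.1 ∧ p.1 ≤ 2 * n + 2} with hS
      set T : Set (ℕ × (Fin d → ℤ)) := {p | 2 * (n + 1) < p.1} with hT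
      have hST : Disjoint S T := Set.disjoint_left.2 fun p h1 h2 => by
        have h3 : p.1 ≤ 2 * n + 2 := h1.2
        have h4 : 2 * (n + 1) < p.1 := h2
        omega
      rw [lintegral_mul_eq_lintegral_mul_lintegral_of_independent_measurableSpace
        (sigmaOf_le ha S) (sigmaOf_le ha T) (indep_sigmaOf ha hind hST)
        (@measurable_deficitWeight d Ω (sigmaOf a S) a n
          (fun p h1 h2 => measurable_sigmaOf a (show p ∈ S from ⟨h1, h2⟩)) H c σ l)
        (@measurable_weightSum d Ω (sigmaOf a T) a N (n + 1)
          (fun p h => measurable_sigmaOf a (show p ∈ T from h)) H c _)]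
      exact mul_le_mul' (lintegral_deficitWeight_le ha hlaw (hfail n σ hσ) l)
        (ih (n + 1) (hσ.next _ _ _ _))
    refine (Finset.sum_le_sum fun l _ => hterm l).trans (le_of_eq ?_)
    simp only [Finset.sum_const, Finset.card_univ, Fintype.card_prod, Fintype.card_fin,
      nsmul_eq_mul]
    push_cast
    ring

end Moments

/-! ### Borel-Cantelli, and the theorem in a fixed dimension. -/

theorem ae_eventually_sum_deficit_le [NeZero d] {Ω : Type*} [MeasurableSpace Ω]
    {P : Measure Ω} [IsProbabilityMeasure P] {a : ℕ × (Fin d → ℤ) → Ω → ℝ}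
    (ha : ∀ p, Measurable (a p)) (hind : iIndepFun a P)
    (hlaw : ∀ p, HasLaw (a p) (gaussianReal 0 (Real.log 2).toNNReal) P) {H : ℝ}
    (hfail : ∀ (n : ℕ) (σ : Node d), σ.Valid →
      ENNReal.ofReal (momentBound H (Real.log (36 * (d : ℝ) ^ 3))) *
        P {ω | Fails (fun p => a p ω) H n σ} ≤ 1) (s : ℤ) :
    ∀ᵐ ω ∂P, ∀ᶠ N : ℕ in atTop, ∀ u : ℤ, u / 9 ^ N = s → ∑ j ∈ Finset.range N,
      deficit (fun p => a p ω) H j (boxPath (richRule (fun p => a p ω) H) (j + 1)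
        (u / 9 ^ (N - (j + 1)))) ≤ N := by
  -- With `exp c` twice the growth rate `18 * d ^ 3`, Markov's inequality gives the summable bound
  -- `2 ^ (-N)`.
  set c := Real.log (36 * (d : ℝ) ^ 3) with hc
  have hd : (1 : ℝ) ≤ d := by exact_mod_cast NeZero.one_le
  have hd3 : (1 : ℝ) ≤ (d : ℝ) ^ 3 := one_le_pow₀ hd
  have hc0 : 0 < c := Real.log_pos (by linarith)
  have hexp : ∀ N : ℕ, ENNReal.ofReal (Real.exp (c * N)) = (36 * (d : ℝ≥0∞) ^ 3) ^ N := by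
    intro N
    rw [mul_comm, Real.exp_nat_mul, hc, Real.exp_log (by linarith),
      ENNReal.ofReal_pow (by positivity), ENNReal.ofReal_mul (by norm_num),
      ENNReal.ofReal_pow (by positivity), ENNReal.ofReal_natCast]
    norm_num
  set σ : Node d := ⟨Pi.single 0 s, Pi.single 0 1, Pi.single 0 1⟩ with hσ
  have hbound : ∀ N : ℕ, P {ω | ENNReal.ofReal (Real.exp (c * N)) ≤
      weightSum (fun p => a p ω) H c N 0 σ} ≤ (2⁻¹ : ℝ≥0∞) ^ N := by
    intro N
    have hd0 : (d : ℝ≥0∞) ≠ 0 := Nat.cast_ne_zero.2 (NeZero.ne d)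
    have h18 : (18 * (d : ℝ≥0∞) ^ 3) ^ N ≠ 0 := pow_ne_zero _ (mul_ne_zero (by norm_num)
      (pow_ne_zero _ hd0))
    have h18' : (18 * (d : ℝ≥0∞) ^ 3) ^ N ≠ ⊤ := by finiteness
    have hpos : ENNReal.ofReal (Real.exp (c * N)) ≠ 0 := by
      rw [Ne, ENNReal.ofReal_eq_zero, not_le]
      positivity
    refine (meas_ge_le_lintegral_div (measurable_weightSum N 0 (fun p _ => ha p) H c σ).aemeasurable
      hpos ENNReal.ofReal_ne_top).trans ?_
    refine (ENNReal.div_le_div_right (lintegral_weightSum_le ha hind hlaw hfail N 0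
      ⟨isStep_single, isStep_single⟩) _).trans (le_of_eq ?_)
    rw [hexp, show (36 * (d : ℝ≥0∞) ^ 3) ^ N = (18 * (d : ℝ≥0∞) ^ 3) ^ N * 2 ^ N by
      rw [← mul_pow]; ring_nf, ENNReal.div_eq_inv_mul,
      ENNReal.mul_inv (Or.inl h18) (Or.inl h18'), mul_right_comm, ENNReal.inv_mul_cancel h18 h18',
      one_mul, ENNReal.inv_pow]
  have hsum : ∑' N : ℕ, P {ω | ENNReal.ofReal (Real.exp (c * N)) ≤
      weightSum (fun p => a p ω) H c N 0 σ} ≠ ⊤ := by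
    refine ne_top_of_le_ne_top ?_ (ENNReal.tsum_le_tsum hbound)
    rw [ENNReal.tsum_geometric]
    norm_num
  filter_upwards [ae_eventually_notMem hsum] with ω hω
  filter_upwards [hω] with N hN u hu
  set R := richRule (fun p => a p ω) H with hR
  have hw := exp_deficit_le_weightSum (fun p => a p ω) H c (fun j => u / 9 ^ (N - j)) N 0
    (fun j hj => by
      rw [Int.ediv_ediv_of_nonneg (by positivity), ← pow_succ]
      congr 2
      omega)
  simp only [Nat.sub_zero, hu, zero_add] at hw
  rw [pathNode_zero, ← hσ] at hw
  have hlt := lt_of_le_of_lt hw (not_le.1 hN)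
  rw [ENNReal.ofReal_lt_ofReal_iff (Real.exp_pos _), Real.exp_lt_exp] at hlt
  exact (lt_of_mul_lt_mul_left hlt hc0.le).le

theorem ae_containsUnboundedPath [NeZero d] {Ω : Type*} [MeasurableSpace Ω]
    {P : Measure Ω} [IsProbabilityMeasure P] {a : ℕ × (Fin d → ℤ) → Ω → ℝ}
    (hind : iIndepFun a P)
    (hlaw : ∀ p, HasLaw (a p) (gaussianReal 0 (Real.log 2).toNNReal) P) {α : ℝ}
    (hd : ENNReal.ofReal (momentBound (α + 2) (Real.log (36 * (d : ℝ) ^ 3))) *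
      ((2 + (d : ℝ≥0∞) ^ 2) *
        (1 - gaussianReal 0 (Real.log 2).toNNReal (Set.Ici (α + 2)) ^ 14) ^ (d - 4)) ≤ 1) :
    ∀ᵐ ω ∂P, ContainsUnboundedPath (thickPoints (fun p => a p ω) α) := by
  -- The variables are only almost everywhere measurable; as the index set is countable, measurable
  -- versions agree with all of them simultaneously, almost surely.
  set b : ℕ × (Fin d → ℤ) → Ω → ℝ := fun p => (hlaw p).aemeasurable.mk (a p) with hb
  have hab : ∀ p, a p =ᵐ[P] b p := fun p => (hlaw p).aemeasurable.ae_eq_mk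
  have hbm : ∀ p, Measurable (b p) := fun p => (hlaw p).aemeasurable.measurable_mk
  have hbind : iIndepFun b P := hind.congr hab
  have hblaw : ∀ p, HasLaw (b p) (gaussianReal 0 (Real.log 2).toNNReal) P :=
    fun p => (hlaw p).congr (hab p).symm
  have hq : ∀ p, P {ω | α + 2 ≤ b p ω}
      = gaussianReal 0 (Real.log 2).toNNReal (Set.Ici (α + 2)) :=
    fun p => (hblaw p).measure_eq (p := fun x => α + 2 ≤ x) measurableSet_Ici
  have hmain := fun s => ae_eventually_sum_deficit_le hbm hbind hblaw (H := α + 2)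
    (fun n σ hσ => (mul_le_mul' le_rfl (measure_fails_le hbm hbind hq n hσ)).trans hd) s
  filter_upwards [ae_all_iff.2 hmain, ae_all_iff.2 hab] with ω hω hωab
  have hfun : (fun p => a p ω) = fun p => b p ω := funext hωab
  rw [hfun]
  exact containsUnboundedPath_of_boxPath _ fun x ⟨s, hx⟩ => mem_thickPoints_of_deficit hω hx

/-! ### The comparison of moments and failures in high dimension. -/

theorem gaussianReal_Ici_ne_zero {v : NNReal} (hv : v ≠ 0) (μ H : ℝ) :
    gaussianReal μ v (Set.Ici H) ≠ 0 := fun h => by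
  have := gaussianReal_absolutelyContinuous' μ hv h
  simp at this

theorem exists_forall_polynomial_log_le (A B D : ℝ) {κ : ℝ} (hκ : 0 < κ) :
    ∃ C : ℝ, ∀ x : ℝ, C ≤ x → A + B * Real.log x + D * Real.log x ^ 2 ≤ κ * x := by
  have h0 : (fun _ : ℝ => A) =o[atTop] (id : ℝ → ℝ) := Asymptotics.isLittleO_const_id_atTop A
  have h1 : (fun x : ℝ => B * Real.log x) =o[atTop] (id : ℝ → ℝ) :=
    Real.isLittleO_log_id_atTop.const_mul_left B
  have h2 : (fun x : ℝ => D * Real.log x ^ 2) =o[atTop] (id : ℝ → ℝ) :=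
    (Real.isLittleO_pow_log_id_atTop (n := 2)).const_mul_left D
  have h := ((h0.add h1).add h2).def hκ
  obtain ⟨C, hC⟩ := eventually_atTop.1 (h.and (eventually_ge_atTop 0))
  refine ⟨C, fun x hx => ?_⟩
  obtain ⟨h3, h4⟩ := hC x hx
  rw [id, Real.norm_eq_abs, Real.norm_eq_abs, abs_of_nonneg h4] at h3
  exact (le_abs_self _).trans h3

/-- In high dimension, failures are so rare that they outweigh the moments of the deficits. -/
theorem exists_dimension_bound {H : ℝ} (hH : 0 < H) {q : ℝ≥0∞} (hq : q ≠ 0) :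
    ∃ C : ℝ, ∀ d : ℕ, C ≤ d → ENNReal.ofReal (momentBound H (Real.log (36 * (d : ℝ) ^ 3))) *
      ((2 + (d : ℝ≥0∞) ^ 2) * (1 - q ^ 14) ^ (d - 4)) ≤ 1 := by
  obtain ⟨κ, hκ, hκq⟩ : ∃ κ : ℝ, 0 < κ ∧ 1 - q ^ 14 ≤ ENNReal.ofReal (Real.exp (-κ)) := by
    have hlt : 1 - q ^ 14 < 1 := ENNReal.sub_lt_self ENNReal.one_ne_top one_ne_zero
      (pow_ne_zero _ hq)
    have hr : (1 - q ^ 14).toReal < 1 := by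
      simpa using (ENNReal.toReal_lt_toReal hlt.ne_top ENNReal.one_ne_top).2 hlt
    refine ⟨-Real.log (max (1 - q ^ 14).toReal (1 / 2)), ?_, ?_⟩
    · exact neg_pos.2 (Real.log_neg (lt_max_of_lt_right (by norm_num)) (max_lt hr (by norm_num)))
    · rw [neg_neg, Real.exp_log (lt_max_of_lt_right (by norm_num))]
      exact (ENNReal.ofReal_toReal hlt.ne_top).ge.trans
        (ENNReal.ofReal_le_ofReal (le_max_left _ _))
  set g := Real.log 36 with hg
  set t := Real.log 2 with ht
  -- These are the coefficients of `1`, `y` and `y ^ 2` in the exponent of `hfin` after `κ * d` is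
  -- moved to the other side; `6 = 2 * 3` collects the prefactors of `hM` and `hd2`.
  obtain ⟨C, hC⟩ := exists_forall_polynomial_log_le (Real.log 6 + 4 * g * H + 8 * g ^ 2 * t + 4 * κ)
    (12 * H + 48 * g * t + 2) (72 * t) hκ
  refine ⟨max C 4, fun d hd => ?_⟩
  have hd4 : (4 : ℝ) ≤ d := (le_max_right _ _).trans hd
  have hd4' : 4 ≤ d := by exact_mod_cast hd4
  have hd0 : (0 : ℝ) < d := by linarith
  have hpoly := hC d ((le_max_left _ _).trans hd)
  set y := Real.log d with hy
  have hy0 : 0 ≤ y := Real.log_nonneg (by linarith)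
  have hlog : Real.log (36 * (d : ℝ) ^ 3) = g + 3 * y := by
    rw [Real.log_mul (by norm_num) (by positivity), Real.log_pow]
    push_cast
    rfl
  have hg0 : 0 ≤ g := Real.log_nonneg (by norm_num)
  have ht0 : 0 ≤ t := Real.log_nonneg (by norm_num)
  have hM : momentBound H (g + 3 * y)
      ≤ 2 * Real.exp (4 * (g + 3 * y) * H + 8 * (g + 3 * y) ^ 2 * t) := by
    have : 1 ≤ Real.exp (4 * (g + 3 * y) * H + 8 * (g + 3 * y) ^ 2 * t) :=
      Real.one_le_exp (by positivity)
    rw [momentBound]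
    linarith
  have hd2 : 2 + (d : ℝ) ^ 2 ≤ 3 * Real.exp (2 * y) := by
    have : Real.exp (2 * y) = (d : ℝ) ^ 2 := by
      rw [mul_comm, Real.exp_mul, hy, Real.exp_log hd0]
      norm_num
    rw [this]
    nlinarith
  have hpow : (1 - q ^ 14) ^ (d - 4) ≤ ENNReal.ofReal (Real.exp (-κ * (d - 4))) := by
    refine (pow_le_pow_left' hκq _).trans (le_of_eq ?_)
    rw [← ENNReal.ofReal_pow (by positivity), ← Real.exp_nat_mul, Nat.cast_sub hd4']
    congr 2
    push_cast
    ring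
  have hdE : (2 + (d : ℝ≥0∞) ^ 2) = ENNReal.ofReal (2 + (d : ℝ) ^ 2) := by
    rw [ENNReal.ofReal_add (by norm_num) (by positivity), ENNReal.ofReal_pow (by positivity),
      ENNReal.ofReal_natCast]
    norm_num
  rw [hlog, hdE]
  refine (mul_le_mul' (ENNReal.ofReal_le_ofReal hM)
    (mul_le_mul' (ENNReal.ofReal_le_ofReal hd2) hpow)).trans ?_
  rw [← ENNReal.ofReal_mul (by positivity), ← ENNReal.ofReal_mul (by positivity),
    ENNReal.ofReal_le_one]
  have hfin : 2 * Real.exp (4 * (g + 3 * y) * H + 8 * (g + 3 * y) ^ 2 * t) *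
      (3 * Real.exp (2 * y) * Real.exp (-κ * (d - 4)))
      = Real.exp (Real.log 6 + (4 * (g + 3 * y) * H + 8 * (g + 3 * y) ^ 2 * t) + 2 * y
        + -κ * (d - 4)) := by
    generalize 4 * (g + 3 * y) * H + 8 * (g + 3 * y) ^ 2 * t = z
    rw [Real.exp_add, Real.exp_add, Real.exp_add, Real.exp_log (by norm_num)]
    ring
  rw [hfin, Real.exp_le_one_iff]
  linarith

end BRW

end

theorem theorem1p3 (α : ℝ) (hα : 0 < α) :
    ∃ C : ℝ, 0 < C ∧ ∀ d : ℕ, C ≤ (d : ℝ) →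
      ∀ {Ω : Type*} [MeasurableSpace Ω] (P : Measure Ω) [IsProbabilityMeasure P]
        (a : ℕ × (Fin d → ℤ) → Ω → ℝ),
        (∀ p, HasLaw (a p) (gaussianReal 0 (Real.log 2).toNNReal) P) →
        iIndepFun a P →
        ∀ᵐ ω ∂P, BRW.ContainsUnboundedPath (BRW.thickPoints (fun p => a p ω) α) := by
  have hv : (Real.log 2).toNNReal ≠ 0 := (Real.toNNReal_pos.2 (Real.log_pos (by norm_num))).ne'
  obtain ⟨C, hC⟩ := BRW.exists_dimension_bound (by linarith : 0 < α + 2)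
    (BRW.gaussianReal_Ici_ne_zero hv 0 (α + 2))
  refine ⟨max C 1, lt_max_of_lt_right one_pos, fun d hd Ω _ P _ a hlaw hind => ?_⟩
  have hd1 : (1 : ℝ) ≤ d := (le_max_right _ _).trans hd
  have : NeZero d := ⟨by rintro rfl; norm_num at hd1⟩
  exact BRW.ae_containsUnboundedPath hind hlaw (hC d ((le_max_left _ _).trans hd))
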